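/- A subspace of $\mathbb R^n$ is called rational if it has a basis of vectors with rational coordinates; let $\mathfrak R_n(e)$ be the set of rational subspaces of $\mathbb R^n$ of dimension $e$. The height $H(B)$ of $B\in\mathfrak R_n(e)$ is the Euclidean norm of a vector of Plücker coordinates of $B$ whose coordinates are setwise coprime integers. For nonzero $X,Y\in\mathbb R^n$ (with the standard Euclidean structure) let $\psi(X,Y)$ be the sine of the angle between $X$ and $Y$. For subspaces $A,B$ of $\mathbb R^n$ of dimensions $d,e$, define inductively $\psi_1(A,B),\dots,\psi_{\min(d,e)}(A,B)$: if unit vectors $X_1,\dots,X_i\in A$ and $Y_1,\dots,Y_i\in B$ have been chosen, let $A_i$ be the orthogonal complement of $\mathrm{span}(X_1,\dots,X_i)$ in $A$ and $B_i$ that of $\mathrm{span}(Y_1,\dots,Y_i)$ in $B$, let $$\psi_{i+1}(A,B)=\min_{X\in A_i\setminus\{0\},\ Y\in B_i\setminus\{0\}}\psi(X,Y),$$ and let $X_{i+1},Y_{i+1}$ be unit vectors attaining this minimum (the numbers $\psi_j(A,B)$ do not depend on the choices). Let $\mathfrak I_n(d,e)_j$ be the set of subspaces $A$ of $\mathbb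 R^n$ of dimension $d$ such that $\dim(A\cap B)<j$ for all $B\in\mathfrak R_n(e)$. For such $A$ let $\mu_n(A|e)_j\in[0,+\infty]$ be the supremum of the $\beta>0$ such that $\psi_j(A,B)\le H(B)^{-\beta}$ for infinitely many $B\in\mathfrak R_n(e)$, and let $$\mathring\mu_n(d|e)_j=\inf_{A\in\mathfrak I_n(d,e)_j}\mu_n(A|e)_j .$$ **Theorem.** Let $n\ge 4$ and let $d,e\in\{1,\dots,n-1\}$ be such that $d+e\le n$; let $j\in\{1,\dots,\min(d,e)\}$. Then $$\mathring\mu_n(d|e)_j\ \ge\ \frac{(n-j)\left(jn-jd+\frac{j^2}{2}+\frac j2+1\right)}{j^2\,(n-e)\left(n-d+\frac j2+\frac12\right)} .$$ -/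

import Mathlib

/-- The Euclidean space `ℝⁿ`. -/
abbrev EucSp (n : ℕ) : Type := EuclideanSpace ℝ (Fin n)

/-- The set of rational subspaces of dimension `e` of `ℝⁿ`: those having a basis of `e` vectors
with rational coordinates. -/
def rationalSubspaces (n e : ℕ) : Set (Submodule ℝ (EucSp n)) :=
  {B | ∃ b : Module.Basis (Fin e) ℝ B, ∀ k i, ∃ q : ℚ, (b k : EucSp n) i = (q : ℝ)}

/-- The set of `(e, j)`-irrational subspaces of dimension `d` of `ℝⁿ`. -/
def irrationalSubspaces (n d e j : ℕ) : Set (Submodule ℝ (EucSp n)) :=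
  {A | Module.finrank ℝ A = d ∧
    ∀ B ∈ rationalSubspaces n e, Module.finrank ℝ (A ⊓ B : Submodule ℝ (EucSp n)) < j}

/-- The Plücker coordinates of a family `v` of `e` vectors of `ℝⁿ`: its minors of size `e`, indexed
by the increasing `e`-tuples of indices. -/
noncomputable def pluckerCoord {n e : ℕ} (v : Fin e → EucSp n) (I : Fin e ↪o Fin n) : ℝ :=
  Matrix.det (Matrix.of fun k l : Fin e => v k (I l))

/-- `Ξ` is an integer vector with setwise coprime coordinates in the (projective) class of Plücker
coordinates of the `e`-dimensional subspace `B`. -/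
def IsPrimitivePlucker {n e : ℕ} (B : Submodule ℝ (EucSp n)) (Ξ : (Fin e ↪o Fin n) → ℤ) : Prop :=
  Finset.univ.gcd Ξ = 1 ∧
    ∃ b : Module.Basis (Fin e) ℝ B, ∃ c : ℝ, c ≠ 0 ∧
      ∀ I, (Ξ I : ℝ) = c * pluckerCoord (fun k => (b k : EucSp n)) I

/-- The height `H(B)` of a rational subspace `B` of dimension `e`: the Euclidean norm of any
primitive integer vector of Plücker coordinates of `B` (see `exists_isPrimitivePlucker` and
`IsPrimitivePlucker.height_eq`: for `B` rational of dimension `e` such a vector exists, and the set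
below is a singleton). -/
noncomputable def height {n : ℕ} (e : ℕ) (B : Submodule ℝ (EucSp n)) : ℝ :=
  sInf {h | ∃ Ξ : (Fin e ↪o Fin n) → ℤ, IsPrimitivePlucker B Ξ ∧ h = √(∑ I, (Ξ I : ℝ) ^ 2)}

/-- Some minor of maximal size of a basis is nonzero. -/
theorem exists_pluckerCoord_ne_zero {n e : ℕ} {B : Submodule ℝ (EucSp n)}
    (b : Module.Basis (Fin e) ℝ B) : ∃ I, pluckerCoord (fun k => (b k : EucSp n)) I ≠ 0 := by
  classical
  set M : Matrix (Fin e) (Fin n) ℝ := Matrix.of fun k i => (b k : EucSp n) i with hM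
  have hli : LinearIndependent ℝ M.row := by
    have h1 := b.linearIndependent.map' B.subtype (Submodule.ker_subtype B)
    exact h1.map' (WithLp.linearEquiv 2 ℝ (Fin n → ℝ)).toLinearMap (LinearEquiv.ker _)
  have hr : Module.finrank ℝ (Submodule.span ℝ (Set.range M.col)) = e := by
    have := hli.rank_matrix
    rw [Matrix.rank_eq_finrank_span_cols] at this
    simpa using this
  obtain ⟨f, hf, -, hfi⟩ := Submodule.exists_fun_fin_finrank_span_eq ℝ (Set.range M.col)
  choose g hg using hf
  have hginj : Function.Injective g := fun x y h => hfi.injective (by rw [← hg, ← hg, h])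
  have hcard : (Finset.univ.image g).card = e := by
    rw [Finset.card_image_of_injective _ hginj]; simpa using hr
  let I : Fin e ↪o Fin n := (Finset.univ.image g).orderEmbOfFin hcard
  have hI : ∀ l, ∃ k, g k = I l := fun l => by
    obtain ⟨k, -, hk⟩ := Finset.mem_image.1 ((Finset.univ.image g).orderEmbOfFin_mem hcard l)
    exact ⟨k, hk⟩
  choose s hs using hI
  have hsinj : Function.Injective s := fun x y h => I.injective (by rw [← hs, ← hs, h])
  refine ⟨I, ?_⟩
  have hc : LinearIndependent ℝ (Matrix.of fun k l : Fin e => (b k : EucSp n) (I l)).col := by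
    have h1 : f ∘ s = (Matrix.of fun k l : Fin e => (b k : EucSp n) (I l)).col := by
      funext l
      simp only [Function.comp, ← hg, hs]
      rfl
    exact h1 ▸ hfi.comp s hsinj
  have := (Matrix.linearIndependent_cols_iff_isUnit.1 hc)
  rw [Matrix.isUnit_iff_isUnit_det] at this
  exact this.ne_zero

/-- A rational subspace has a primitive integer vector of Plücker coordinates. -/
theorem exists_isPrimitivePlucker {n e : ℕ} {B : Submodule ℝ (EucSp n)}
    (hB : B ∈ rationalSubspaces n e) : ∃ Ξ : (Fin e ↪o Fin n) → ℤ, IsPrimitivePlucker B Ξ := by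
  classical
  obtain ⟨b, hb⟩ := hB
  choose q hq using hb
  let r : (Fin e ↪o Fin n) → ℚ := fun I => Matrix.det (Matrix.of fun k l : Fin e => q k (I l))
  have hr : ∀ I, pluckerCoord (fun k => (b k : EucSp n)) I = (r I : ℝ) := fun I => by
    simp only [pluckerCoord, r, hq]
    exact (RingHom.map_det (algebraMap ℚ ℝ) _).symm
  obtain ⟨m, hm⟩ := IsLocalization.exist_integer_multiples_of_finite (nonZeroDivisors ℤ) r
  have hm0 : (m : ℤ) ≠ 0 := nonZeroDivisors.ne_zero m.2
  choose z hz using hm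
  have hz' : ∀ I, (z I : ℝ) = (m : ℤ) * pluckerCoord (fun k => (b k : EucSp n)) I := fun I => by
    have h1 : (z I : ℚ) = (m : ℤ) * r I := by simpa using hz I
    rw [hr]
    exact_mod_cast h1
  obtain ⟨I, hI⟩ := exists_pluckerCoord_ne_zero b
  have hzI : z I ≠ 0 := fun h => by
    have := hz' I
    rw [h] at this
    simp [hI, hm0] at this
  obtain ⟨Ξ, h1, h2⟩ := Finset.extract_gcd z ⟨I, Finset.mem_univ I⟩
  have hg : Finset.univ.gcd z ≠ 0 := fun h => hzI (by rw [h1 I (Finset.mem_univ I), h, zero_mul])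
  refine ⟨Ξ, h2, b, (m : ℤ) / (Finset.univ.gcd z : ℤ), ?_, fun J => ?_⟩
  · have : ((Finset.univ.gcd z : ℤ) : ℝ) ≠ 0 := by exact_mod_cast hg
    have : ((m : ℤ) : ℝ) ≠ 0 := by exact_mod_cast hm0
    positivity
  · have hg' : ((Finset.univ.gcd z : ℤ) : ℝ) ≠ 0 := by exact_mod_cast hg
    have h3 : (z J : ℝ) = (Finset.univ.gcd z : ℤ) * (Ξ J : ℝ) := by
      exact_mod_cast h1 J (Finset.mem_univ J)
    rw [hz'] at h3
    field_simp
    linarith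

/-- The Plücker coordinates of two bases are proportional. -/
theorem pluckerCoord_basis {n e : ℕ} {B : Submodule ℝ (EucSp n)} (b b' : Module.Basis (Fin e) ℝ B)
    (I : Fin e ↪o Fin n) : pluckerCoord (fun k => (b' k : EucSp n)) I =
      (b.toMatrix b').det * pluckerCoord (fun k => (b k : EucSp n)) I := by
  unfold pluckerCoord
  rw [← Matrix.det_transpose (b.toMatrix b'), ← Matrix.det_mul]
  congr 1
  ext k l
  have := congrArg (fun v : B => (v : EucSp n) (I l)) (b.sum_toMatrix_smul_self b' k)
  simp only [Submodule.coe_sum, Submodule.coe_smul] at this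
  simp [Matrix.mul_apply, ← this]

/-- The norm of a primitive vector of Plücker coordinates does not depend on its choice. -/
theorem IsPrimitivePlucker.height_eq {n e : ℕ} {B : Submodule ℝ (EucSp n)}
    {Ξ : (Fin e ↪o Fin n) → ℤ} (h : IsPrimitivePlucker B Ξ) :
    height e B = √(∑ I, (Ξ I : ℝ) ^ 2) := by
  have key : ∀ Ξ', IsPrimitivePlucker B Ξ' → ∀ I, Ξ' I ^ 2 = Ξ I ^ 2 := by
    rintro Ξ' ⟨hg', b', c', hc', hp'⟩
    obtain ⟨hg, b, c, hc, hp⟩ := h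
    have h1 : ∀ I, (Ξ' I : ℝ) = (c' * (b.toMatrix b').det / c) * Ξ I := fun I => by
      rw [hp', hp, pluckerCoord_basis b b']; field_simp
    obtain ⟨u, hu⟩ := Finset.gcd_eq_sum_mul Finset.univ Ξ
    rw [hg] at hu
    have h2 : c' * (b.toMatrix b').det / c = ((∑ I, Ξ' I * u I : ℤ) : ℝ) := by
      have hu' : (1 : ℝ) = ∑ I, (Ξ I : ℝ) * u I := by exact_mod_cast hu
      push_cast
      simp only [h1, mul_assoc, ← Finset.mul_sum]
      rw [← hu', mul_one]
    rw [h2] at h1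
    set m := ∑ I, Ξ' I * u I
    have h3 : ∀ I, Ξ' I = m * Ξ I := fun I => by exact_mod_cast h1 I
    have h4 : m ∣ 1 := hg' ▸ Finset.dvd_gcd fun I _ => ⟨_, h3 I⟩
    have h5 : m ^ 2 = 1 := by
      rcases Int.isUnit_iff.1 (isUnit_of_dvd_one h4) with h | h <;> simp [h]
    intro I
    rw [h3, mul_pow, h5, one_mul]
  have : {x | ∃ Ξ : (Fin e ↪o Fin n) → ℤ, IsPrimitivePlucker B Ξ ∧ x = √(∑ I, (Ξ I : ℝ) ^ 2)} =
      {√(∑ I, (Ξ I : ℝ) ^ 2)} := by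
    ext x
    simp only [Set.mem_ofPred_eq, Set.mem_singleton_iff]
    constructor
    · rintro ⟨Ξ', h', rfl⟩
      congr 1
      exact Finset.sum_congr rfl fun I _ => by exact_mod_cast key Ξ' h' I
    · rintro rfl
      exact ⟨Ξ, h, rfl⟩
  rw [height, this, csInf_singleton]

/-- The distance `ψ(X, Y)` between two nonzero vectors: the sine of their angle. -/
noncomputable def psiVec {n : ℕ} (X Y : EucSp n) : ℝ :=
  Real.sin (InnerProductGeometry.angle X Y)

/-- The orthogonal complement, in `A`, of the span of `X 1, …, X i`. -/
noncomputable def remainder {n : ℕ} (A : Submodule ℝ (EucSp n)) (X : ℕ → EucSp n) (i : ℕ) :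
    Submodule ℝ (EucSp n) :=
  A ⊓ (Submodule.span ℝ (X '' Set.Icc 1 i))ᗮ

/-- `(X 1, Y 1), …, (X j, Y j)` are pairs of unit vectors produced by the inductive construction of
the canonical angles between `A` and `B`: for `i < j`, the pair `(X (i + 1), Y (i + 1))` minimizes
`ψ` among the pairs of nonzero vectors of `A` and `B` orthogonal to `X 1, …, X i` and to
`Y 1, …, Y i` respectively. (Only the values of `X` and `Y` at `1, …, j` matter.) -/
def IsCanonicalPairs {n : ℕ} (A B : Submodule ℝ (EucSp n)) (j : ℕ) (X Y : ℕ → EucSp n) : Prop :=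
  ∀ i < j, X (i + 1) ∈ remainder A X i ∧ Y (i + 1) ∈ remainder B Y i ∧
    ‖X (i + 1)‖ = 1 ∧ ‖Y (i + 1)‖ = 1 ∧
    ∀ x ∈ remainder A X i, ∀ y ∈ remainder B Y i, x ≠ 0 → y ≠ 0 →
      psiVec (X (i + 1)) (Y (i + 1)) ≤ psiVec x y

/-- The inductive construction of the canonical angles can be carried out. -/
theorem exists_isCanonicalPairs {n : ℕ} (A B : Submodule ℝ (EucSp n)) (j : ℕ)
    (hA : j ≤ Module.finrank ℝ A) (hB : j ≤ Module.finrank ℝ B) :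
    ∃ X Y : ℕ → EucSp n, IsCanonicalPairs A B j X Y := by
  induction j with
  | zero => exact ⟨0, 0, fun i hi => absurd hi (Nat.not_lt_zero i)⟩
  | succ j ih =>
    obtain ⟨X, Y, hXY⟩ := ih (by omega) (by omega)
    have hex : ∀ (C : Submodule ℝ (EucSp n)) (Z : ℕ → EucSp n), j + 1 ≤ Module.finrank ℝ C →
        ∃ z ∈ remainder C Z j, ‖z‖ = 1 := by
      intro C Z hC
      have h0 : remainder C Z j ≠ ⊥ := by
        intro h
        set S := Submodule.span ℝ (Z '' Set.Icc 1 j) with hS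
        have h1 : Module.finrank ℝ S ≤ j := by
          have h := finrank_span_finset_le_card (R := ℝ) ((Finset.Icc 1 j).image Z)
          have h' := Finset.card_image_le (s := Finset.Icc 1 j) (f := Z)
          rw [Nat.card_Icc, Nat.add_sub_cancel] at h'
          rw [Finset.coe_image, Finset.coe_Icc] at h
          exact h.trans h'
        have h2 := S.finrank_add_finrank_orthogonal
        have h3 := Submodule.finrank_sup_add_finrank_inf_eq C Sᗮ
        have h4 := Submodule.finrank_le (C ⊔ Sᗮ)
        have h5 : C ⊓ Sᗮ = ⊥ := h
        rw [h5, finrank_bot] at h3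
        omega
      obtain ⟨z, hz, hz0⟩ := Submodule.exists_mem_ne_zero_of_ne_bot h0
      exact ⟨(‖z‖⁻¹ : ℝ) • z, Submodule.smul_mem _ _ hz, by
        rw [norm_smul, norm_inv, norm_norm, inv_mul_cancel₀ (norm_ne_zero_iff.2 hz0)]⟩
    obtain ⟨x₀, hx₀, hx₀'⟩ := hex A X hA
    obtain ⟨y₀, hy₀, hy₀'⟩ := hex B Y hB
    have hcpt : ∀ C : Submodule ℝ (EucSp n),
        IsCompact ((C : Set (EucSp n)) ∩ Metric.sphere 0 1) := fun C =>
      (isCompact_sphere _ _).inter_left C.closed_of_finiteDimensional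
    obtain ⟨⟨x, y⟩, ⟨⟨hx, hx1⟩, hy, hy1⟩, hmin⟩ :=
      ((hcpt (remainder A X j)).prod (hcpt (remainder B Y j))).exists_isMinOn
        (f := fun p : EucSp n × EucSp n => psiVec p.1 p.2)
        ⟨(x₀, y₀), ⟨hx₀, by simpa using hx₀'⟩, hy₀, by simpa using hy₀'⟩
        (by
          rintro ⟨x, y⟩ ⟨⟨-, hx1⟩, -, hy1⟩
          refine (Real.continuous_sin.continuousAt.comp
            (InnerProductGeometry.continuousAt_angle (x := (x, y)) ?_ ?_)).continuousWithinAt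
          · rintro rfl; simp at hx1
          · rintro rfl; simp at hy1)
    rw [mem_sphere_zero_iff_norm] at hx1 hy1
    have hrem : ∀ (C : Submodule ℝ (EucSp n)) (Z : ℕ → EucSp n) (z : EucSp n), ∀ i ≤ j,
        remainder C (Function.update Z (j + 1) z) i = remainder C Z i := by
      intro C Z z i hi
      unfold remainder
      congr 3
      refine Set.image_congr fun k hk => Function.update_of_ne ?_ _ _
      have := hk.2
      omega
    refine ⟨Function.update X (j + 1) x, Function.update Y (j + 1) y, fun i hi => ?_⟩
    rw [hrem A X x i (by omega), hrem B Y y i (by omega)]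
    rcases Nat.lt_succ_iff_lt_or_eq.1 hi with h | rfl
    · rw [Function.update_of_ne (by omega), Function.update_of_ne (by omega)]
      exact hXY i h
    · rw [Function.update_self, Function.update_self]
      refine ⟨hx, hy, hx1, hy1, fun u hu v hv hu0 hv0 => ?_⟩
      have hu1 : (0 : ℝ) < ‖u‖⁻¹ := by positivity
      have hv1 : (0 : ℝ) < ‖v‖⁻¹ := by positivity
      have := hmin (a := ((‖u‖⁻¹ : ℝ) • u, (‖v‖⁻¹ : ℝ) • v))
        ⟨⟨Submodule.smul_mem _ _ hu, by
            simp [norm_smul, inv_mul_cancel₀ (norm_ne_zero_iff.2 hu0)]⟩,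
          Submodule.smul_mem _ _ hv, by
            simp [norm_smul, inv_mul_cancel₀ (norm_ne_zero_iff.2 hv0)]⟩
      simpa [psiVec, InnerProductGeometry.angle_smul_left_of_pos _ _ hu1,
        InnerProductGeometry.angle_smul_right_of_pos _ _ hv1] using this

/-- `ψ_j(A, B)`, for `1 ≤ j ≤ min (dim A) (dim B)`: the value `ψ(X_j, Y_j)` for pairs
`(X_1, Y_1), …, (X_j, Y_j)` as above. Such pairs exist (`exists_isCanonicalPairs`), and the value
does not depend on them. -/
noncomputable def psi {n : ℕ} (j : ℕ) (A B : Submodule ℝ (EucSp n)) : ℝ :=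
  sInf {r | ∃ X Y : ℕ → EucSp n, IsCanonicalPairs A B j X Y ∧ r = psiVec (X j) (Y j)}

/-- The exponent `μ_n(A|e)_j`: the supremum, in the extended reals, of the `β > 0` such that
`ψ_j(A, B) ≤ H(B)^{-β}` for infinitely many rational subspaces `B` of dimension `e`. -/
noncomputable def muExp {n : ℕ} (A : Submodule ℝ (EucSp n)) (e j : ℕ) : EReal :=
  sSup {x | ∃ β : ℝ, 0 < β ∧
    {B ∈ rationalSubspaces n e | psi j A B ≤ 1 / height e B ^ β}.Infinite ∧ x = (β : EReal)}

/-- `μ̊_n(d|e)_j`: the infimum of `μ_n(A|e)_j` over the `(e, j)`-irrational subspaces `A` of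
dimension `d`. -/
noncomputable def muRing (n d e j : ℕ) : EReal :=
  sInf {x | ∃ A ∈ irrationalSubspaces n d e j, x = muExp A e j}

/-!
Let `y_1, …, y_j` be the first vectors of the reduced echelon basis of `A`. Among their coordinates
only `j * (n - d)` can differ from `0` and `1`, so Dirichlet's theorem rounds these vectors with a
common denominator `q ≤ Q ^ (j * (n - d))` and an error at most `1 / (q * Q)`. The rounded vectors
span a rational subspace `B` of dimension `j` and height `≪ q ^ j` which lies within `≪ 1 / (q * Q)`
of `A`.

Next, `B` is contained in a rational subspace `C` of dimension `e` and height
`≪ H(B) ^ ((n - e) / (n - j))`, obtained by adjoining one integer vector at a time. If `Ξ` is a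
primitive vector of Plücker coordinates of `B` and `Ξ_I` is its largest coordinate, the integer
combinations of the echelon basis of `B` form at least `|Ξ_I|` classes modulo `ℤⁿ`. Two of these are
close by the pigeonhole principle, and their difference yields an integer vector near `B`.

A dimension count gives `ψ_j(A, C) ≪ 1 / (q * Q)`, and the irrationality of `A` forces infinitely
many `C` to occur as `Q → ∞`. Since `q ≤ Q ^ (j * (n - d))`, this yields every exponent below
`(n - j) / (j * (n - e)) * (1 + 1 / (j * (n - d)))`. The bound of the theorem has
`n - d + j / 2 + 1 / 2` in place of the last `n - d`.
-/

open Module Submodule Filter Topology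

section Nearness

variable {E : Type*} [NormedAddCommGroup E] [InnerProductSpace ℝ E] {A B C : Submodule ℝ E}

/-- Every nonzero vector of `B` makes with its orthogonal projection onto `A` an angle of sine at
most `ε`, that is, `B` lies in the cone of aperture `arcsin ε` around `A`. The condition is written
without quotients, so that it makes sense for the zero vector. -/
def IsNear (A B : Submodule ℝ E) [A.HasOrthogonalProjection] (ε : ℝ) : Prop :=
  ∀ x ∈ B, ‖x - A.starProjection x‖ ≤ ε * ‖x‖

theorem norm_sub_starProjection_le_norm_sub [A.HasOrthogonalProjection] (x : E) {a : E}
    (ha : a ∈ A) : ‖x - A.starProjection x‖ ≤ ‖x - a‖ := by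
  rw [A.starProjection_minimal]
  exact ciInf_le ⟨0, Set.forall_mem_range.2 fun _ => norm_nonneg _⟩ (⟨a, ha⟩ : A)

theorem IsNear.mono [A.HasOrthogonalProjection] {ε ε' : ℝ} (h : IsNear A B ε) (hε : ε ≤ ε') :
    IsNear A B ε' :=
  fun x hx => (h x hx).trans (mul_le_mul_of_nonneg_right hε (norm_nonneg x))

theorem exists_mem_orthogonal_ne_zero [FiniteDimensional ℝ A] [FiniteDimensional ℝ B]
    (h : finrank ℝ A < finrank ℝ B) : ∃ y ∈ B, y ∈ Aᗮ ∧ y ≠ 0 := by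
  obtain ⟨y, hy, hy0⟩ := exists_mem_ne_zero_of_ne_bot
    (LinearMap.ker_ne_bot_of_finrank_lt
      (f := A.orthogonalProjectionOnto.toLinearMap ∘ₗ B.subtype) h)
  exact ⟨y, y.2, orthogonalProjectionOnto_eq_zero_iff.1 hy,
    fun h => hy0 (Subtype.ext h)⟩

theorem exists_pos_mul_norm_le_norm_sub_starProjection (A C : Submodule ℝ E)
    [A.HasOrthogonalProjection] [FiniteDimensional ℝ C] :
    ∃ η > 0, ∀ y ∈ C, y ∈ (A ⊓ C)ᗮ → η * ‖y‖ ≤ ‖y - A.starProjection y‖ := by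
  have : FiniteDimensional ℝ (C ⊓ (A ⊓ C)ᗮ : Submodule ℝ E) := finiteDimensional_inf_left _ _
  let f : (C ⊓ (A ⊓ C)ᗮ : Submodule ℝ E) →ₗ[ℝ] E :=
    (LinearMap.id - A.starProjection.toLinearMap) ∘ₗ Submodule.subtype _
  have hf : LinearMap.ker f = ⊥ := by
    refine LinearMap.ker_eq_bot'.2 fun y hy => Subtype.ext ?_
    have hyA : (y : E) ∈ A := starProjection_eq_self_iff.1 (sub_eq_zero.1 hy).symm
    exact inner_self_eq_zero.1 (inner_right_of_mem_orthogonal (mem_inf.2 ⟨hyA, y.2.1⟩) y.2.2)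
  obtain ⟨K, hK0, hK⟩ := f.exists_antilipschitzWith hf
  refine ⟨(K : ℝ)⁻¹, inv_pos.2 hK0, fun y hyC hyo => ?_⟩
  rw [inv_mul_le_iff₀ (by exact_mod_cast hK0)]
  exact hK.le_mul_norm (map_zero f) ⟨y, hyC, hyo⟩

theorem exists_pos_le_of_isNear (A C : Submodule ℝ E) [A.HasOrthogonalProjection]
    [FiniteDimensional ℝ C] :
    ∃ η > 0, ∀ B ≤ C, finrank ℝ (A ⊓ C : Submodule ℝ E) < finrank ℝ B →
      ∀ ε, IsNear A B ε → η ≤ ε := by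
  obtain ⟨η, hη, hle⟩ := exists_pos_mul_norm_le_norm_sub_starProjection A C
  refine ⟨η, hη, fun B hBC hlt ε hε => ?_⟩
  have := finiteDimensional_of_le hBC
  obtain ⟨y, hyB, hyo, hy0⟩ := exists_mem_orthogonal_ne_zero hlt
  exact le_of_mul_le_mul_right ((hle y (hBC hyB) hyo).trans (hε y hyB)) (norm_pos_iff.2 hy0)

/-- Each single member of `𝒞` stays at a positive distance from `A`, so finitely many members
cannot come arbitrarily close. -/
theorem infinite_of_forall_exists_isNear [A.HasOrthogonalProjection] [FiniteDimensional ℝ E] {j : ℕ}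
    {𝒞 : Set (Submodule ℝ E)} (hA : ∀ C ∈ 𝒞, finrank ℝ (A ⊓ C : Submodule ℝ E) < j)
    (h : ∀ ε > 0, ∃ C ∈ 𝒞, ∃ B ≤ C, finrank ℝ B = j ∧ IsNear A B ε) : 𝒞.Infinite := by
  intro hfin
  choose η hη hle using exists_pos_le_of_isNear A
  obtain ⟨ε, hε, hε0⟩ := (((eventually_all_finite hfin).2 fun C _ =>
    (gt_mem_nhds (hη C)).filter_mono nhdsWithin_le_nhds).and
      (self_mem_nhdsWithin (a := (0 : ℝ)) (s := Set.Ioi 0))).exists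
  obtain ⟨C, hC, B, hBC, hB, hnear⟩ := h ε hε0
  exact (hε C hC).not_ge (hle C B hBC (hB ▸ hA C hC) ε hnear)

end Nearness

section CanonicalAngles

variable {n : ℕ} {A B C : Submodule ℝ (EucSp n)} {X Y : ℕ → EucSp n} {i j k : ℕ}

theorem psiVec_nonneg (x y : EucSp n) : 0 ≤ psiVec x y :=
  InnerProductGeometry.sin_angle_nonneg x y

theorem psiVec_sq_mul (x y : EucSp n) :
    psiVec x y ^ 2 * (‖x‖ ^ 2 * ‖y‖ ^ 2) = ‖x‖ ^ 2 * ‖y‖ ^ 2 - inner ℝ x y ^ 2 := by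
  rw [psiVec, Real.sin_sq, ← InnerProductGeometry.cos_angle_mul_norm_mul_norm x y]
  ring

theorem psiVec_starProjection_mul_norm {y : EucSp n} (hy : A.starProjection y ≠ 0) :
    psiVec (A.starProjection y) y * ‖y‖ = ‖y - A.starProjection y‖ := by
  have horth : inner ℝ (A.starProjection y) (y - A.starProjection y) = 0 := by
    rw [real_inner_comm]
    exact starProjection_inner_eq_zero y _ (A.starProjection_apply_mem y)
  have hsin := InnerProductGeometry.sin_angle_add_of_inner_eq_zero horth (Or.inl hy)
  have hy0 : ‖y‖ ≠ 0 := norm_ne_zero_iff.2 fun h => hy (by rw [h, map_zero])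
  rw [add_sub_cancel] at hsin
  rw [psiVec, hsin, div_mul_cancel₀ _ hy0]

theorem inner_sq_le_of_psiVec_le {x y z : EucSp n} (hx : ‖x‖ = 1) (hy : ‖y‖ = 1)
    (h : psiVec x y ≤ psiVec x z) : inner ℝ x z ^ 2 ≤ inner ℝ x y ^ 2 * ‖z‖ ^ 2 := by
  have hxy := psiVec_sq_mul x y
  have hxz := psiVec_sq_mul x z
  have hsq : psiVec x y ^ 2 ≤ psiVec x z ^ 2 := pow_le_pow_left₀ (psiVec_nonneg _ _) h 2
  simp only [hx, hy, one_pow, one_mul, mul_one] at hxy hxz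
  nlinarith [mul_le_mul_of_nonneg_right hsq (sq_nonneg ‖z‖)]

theorem inner_eq_zero_of_psiVec_minimal {x y z : EucSp n} (hx : ‖x‖ = 1) (hy : ‖y‖ = 1)
    (hyB : y ∈ B) (hmin : ∀ v ∈ B, v ≠ 0 → psiVec x y ≤ psiVec x v) (hzB : z ∈ B)
    (hyz : inner ℝ y z = 0) : inner ℝ x z = 0 := by
  have hle : ∀ v ∈ B, inner ℝ x v ^ 2 ≤ inner ℝ x y ^ 2 * ‖v‖ ^ 2 := fun v hv => by
    rcases eq_or_ne v 0 with rfl | hv0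
    · simp
    · exact inner_sq_le_of_psiVec_le hx hy (hmin v hv hv0)
  -- test the minimality on the projection of `x` to the plane of `y` and `z`, rescaled by `‖z‖ ^ 2`
  set a := inner ℝ x y
  set b := inner ℝ x z with hb
  have hnorm : ‖(a * ‖z‖ ^ 2) • y + b • z‖ ^ 2 = ‖z‖ ^ 2 * (a ^ 2 * ‖z‖ ^ 2 + b ^ 2) := by
    rw [norm_add_sq_real, norm_smul, norm_smul, real_inner_smul_left, real_inner_smul_right, hyz,
      hy, mul_pow, mul_pow, Real.norm_eq_abs, Real.norm_eq_abs, sq_abs, sq_abs]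
    ring
  have hineq := hle _ (B.add_mem (B.smul_mem (a * ‖z‖ ^ 2) hyB) (B.smul_mem b hzB))
  rw [hnorm, inner_add_right, real_inner_smul_right, real_inner_smul_right, ← hb] at hineq
  have hb4 : b ^ 4 ≤ 0 := by nlinarith [mul_nonneg (sq_nonneg (a * b)) (sq_nonneg ‖z‖)]
  exact pow_eq_zero_iff (by norm_num) |>.1 (hb4.antisymm (by positivity))

theorem remainder_anti (A : Submodule ℝ (EucSp n)) (X : ℕ → EucSp n) : Antitone (remainder A X) :=
  fun _ _ h => inf_le_inf_left A
    (orthogonal_le (span_mono (Set.image_mono (Set.Icc_subset_Icc_right h))))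

theorem mem_remainder {y : EucSp n} :
    y ∈ remainder A X i ↔ y ∈ A ∧ ∀ k ∈ Set.Icc 1 i, inner ℝ (X k) y = 0 := by
  rw [remainder, mem_inf, ← span_singleton_le_iff_mem y (_ᗮ), ← isOrtho_iff_le, isOrtho_comm,
    isOrtho_span]
  simp only [Set.forall_mem_image, Set.mem_singleton_iff, forall_eq]

theorem finrank_span_image_Icc_le (X : ℕ → EucSp n) (i : ℕ) :
    finrank ℝ (span ℝ (X '' Set.Icc 1 i)) ≤ i := by
  classical
  rw [← Finset.coe_Icc, ← Finset.coe_image]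
  exact (finrank_span_finset_le_card _).trans (Finset.card_image_le.trans (by simp))

namespace IsCanonicalPairs

theorem left_mem (h : IsCanonicalPairs A C j X Y) (hk : k ∈ Set.Icc 1 j) : X k ∈ A := by
  obtain ⟨k, rfl⟩ := Nat.exists_eq_add_of_le' hk.1
  exact (h k hk.2).1.1

theorem inner_eq_zero (h : IsCanonicalPairs A C j X Y) (hi : i ≤ j) {y : EucSp n}
    (hy : y ∈ remainder C Y i) (hk : k ∈ Set.Icc 1 i) : inner ℝ (X k) y = 0 := by
  obtain ⟨k, rfl⟩ := Nat.exists_eq_add_of_le' hk.1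
  obtain ⟨hX, hY, hX1, hY1, hmin⟩ := h k (hk.2.trans hi)
  have hX0 : X (k + 1) ≠ 0 := norm_ne_zero_iff.1 (hX1 ▸ one_ne_zero)
  exact inner_eq_zero_of_psiVec_minimal hX1 hY1 hY (fun v hv => hmin _ hX v hv hX0)
    (remainder_anti C Y (Nat.le_of_succ_le hk.2) hy) ((mem_remainder.1 hy).2 _ hk)

theorem starProjection_mem_remainder (h : IsCanonicalPairs A C j X Y) (hi : i ≤ j) {y : EucSp n}
    (hy : y ∈ remainder C Y i) : A.starProjection y ∈ remainder A X i := by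
  refine mem_remainder.2 ⟨A.starProjection_apply_mem y, fun k hk => ?_⟩
  rw [← inner_starProjection_left_eq_right,
    starProjection_eq_self_iff.2 (h.left_mem ⟨hk.1, hk.2.trans hi⟩)]
  exact h.inner_eq_zero hi hy hk

theorem psi_le_psiVec (h : IsCanonicalPairs A C j X Y) : psi j A C ≤ psiVec (X j) (Y j) :=
  csInf_le ⟨0, by rintro _ ⟨X, Y, -, rfl⟩; exact psiVec_nonneg _ _⟩ ⟨X, Y, h, rfl⟩

end IsCanonicalPairs

/-- A dimension count gives a `y ∈ B` orthogonal to `Y 1, …, Y (j - 1)`; its projection onto `A` is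
then orthogonal to `X 1, …, X (j - 1)`, so that both compete for the `j`-th canonical angle. -/
theorem psi_le_of_isNear {ε : ℝ} (hj : 1 ≤ j) (hA : j ≤ finrank ℝ A) (hB : finrank ℝ B = j)
    (hBC : B ≤ C) (hε : IsNear A B ε) : psi j A C ≤ ε := by
  obtain ⟨i, rfl⟩ := Nat.exists_eq_add_of_le' hj
  obtain ⟨X, Y, hXY⟩ := exists_isCanonicalPairs A C (i + 1) hA (hB ▸ finrank_mono hBC)
  refine hXY.psi_le_psiVec.trans ?_
  obtain ⟨y, hyB, hyY, hy0⟩ := exists_mem_orthogonal_ne_zero (B := B)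
    ((Nat.lt_succ_of_le (finrank_span_image_Icc_le Y i)).trans_eq hB.symm)
  have hy : y ∈ remainder C Y i := ⟨hBC hyB, hyY⟩
  have hy_pos : 0 < ‖y‖ := norm_pos_iff.2 hy0
  by_cases hp : A.starProjection y = 0
  · have hle := hε y hyB
    rw [hp, sub_zero] at hle
    exact (Real.sin_le_one _).trans ((le_mul_iff_one_le_left hy_pos).1 hle)
  · obtain ⟨-, -, -, -, hmin⟩ := hXY i (Nat.lt_succ_self i)
    have hpr := hXY.starProjection_mem_remainder (Nat.le_succ i) hy
    refine (hmin _ hpr y hy hp hy0).trans (le_of_mul_le_mul_right ?_ hy_pos)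
    rw [psiVec_starProjection_mul_norm hp]
    exact hε y hyB

end CanonicalAngles

section Heights

variable {n e : ℕ} {B : Submodule ℝ (EucSp n)} {v : Fin e → EucSp n} {Ξ : (Fin e ↪o Fin n) → ℤ}

theorem span_range_coe_basis {ι R M : Type*} [Semiring R] [AddCommMonoid M] [Module R M]
    {N : Submodule R M} (b : Basis ι R N) : span R (Set.range fun k => (b k : M)) = N := by
  rw [show (fun k => (b k : M)) = N.subtype ∘ b from rfl, Set.range_comp, ← map_span, b.span_eq,
    Submodule.map_top, range_subtype]

theorem mem_rationalSubspaces_iff : B ∈ rationalSubspaces n e ↔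
    ∃ v : Fin e → EucSp n, LinearIndependent ℝ v ∧ (∀ k i, ∃ q : ℚ, v k i = q) ∧
      span ℝ (Set.range v) = B := by
  constructor
  · rintro ⟨b, hb⟩
    exact ⟨fun k => b k, b.linearIndependent.map' B.subtype B.ker_subtype, hb,
      span_range_coe_basis b⟩
  · rintro ⟨v, hv, hq, rfl⟩
    exact ⟨Basis.span hv, by simpa only [Basis.span_apply] using hq⟩

theorem finrank_of_mem_rationalSubspaces (hB : B ∈ rationalSubspaces n e) : finrank ℝ B = e := by
  obtain ⟨b, -⟩ := hB
  rw [finrank_eq_card_basis b, Fintype.card_fin]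

theorem exists_pluckerCoord_ne_zero_of_linearIndependent (hv : LinearIndependent ℝ v) :
    ∃ I, pluckerCoord v I ≠ 0 := by
  simpa only [Basis.span_apply] using exists_pluckerCoord_ne_zero (Basis.span hv)

namespace IsPrimitivePlucker

theorem exists_ne_zero (h : IsPrimitivePlucker B Ξ) : ∃ I, Ξ I ≠ 0 := by
  by_contra! h0
  exact one_ne_zero (h.1.symm.trans (Finset.gcd_eq_zero_iff.2 fun I _ => h0 I))

theorem abs_le_height (h : IsPrimitivePlucker B Ξ) (I : Fin e ↪o Fin n) :
    |(Ξ I : ℝ)| ≤ height e B := by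
  rw [h.height_eq]
  exact Real.abs_le_sqrt (Finset.single_le_sum (f := fun J => (Ξ J : ℝ) ^ 2)
    (fun _ _ => sq_nonneg _) (Finset.mem_univ I))

theorem exists_eq_mul_pluckerCoord (h : IsPrimitivePlucker (span ℝ (Set.range v)) Ξ)
    (hv : LinearIndependent ℝ v) : ∃ c ≠ 0, ∀ I, (Ξ I : ℝ) = c * pluckerCoord v I := by
  obtain ⟨I, hI⟩ := h.exists_ne_zero
  obtain ⟨-, b, c, -, hb⟩ := h
  have hΞ : ∀ J, (Ξ J : ℝ) = c * ((Basis.span hv).toMatrix b).det * pluckerCoord v J := fun J => by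
    rw [hb, pluckerCoord_basis (Basis.span hv) b, mul_assoc]
    simp only [Basis.span_apply]
  refine ⟨_, fun h0 => hI ?_, hΞ⟩
  exact Int.cast_eq_zero.1 ((hΞ I).trans (by rw [h0, zero_mul]))

end IsPrimitivePlucker

theorem one_le_height (hB : B ∈ rationalSubspaces n e) : 1 ≤ height e B := by
  obtain ⟨Ξ, h⟩ := exists_isPrimitivePlucker hB
  obtain ⟨I, hI⟩ := h.exists_ne_zero
  exact le_trans (by exact_mod_cast Int.one_le_abs hI) (h.abs_le_height I)

theorem sqrt_sum_sq_le_sum_abs {ι : Type*} (s : Finset ι) (f : ι → ℝ) :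
    √(∑ i ∈ s, f i ^ 2) ≤ ∑ i ∈ s, |f i| := by
  refine Real.sqrt_le_iff.2 ⟨Finset.sum_nonneg fun _ _ => abs_nonneg _, ?_⟩
  simpa only [sq_abs] using Finset.sum_sq_le_sq_sum_of_nonneg fun i (_ : i ∈ s) => abs_nonneg (f i)

theorem height_span_le (hv : LinearIndependent ℝ v) {z : (Fin e ↪o Fin n) → ℤ} {c : ℝ}
    (hc : c ≠ 0) (hz : ∀ I, (z I : ℝ) = c * pluckerCoord v I) :
    height e (span ℝ (Set.range v)) ≤ ∑ I, |(z I : ℝ)| := by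
  obtain ⟨I, hI⟩ := exists_pluckerCoord_ne_zero_of_linearIndependent hv
  obtain ⟨Ξ, hzΞ, hgcd⟩ := Finset.extract_gcd z ⟨I, Finset.mem_univ I⟩
  set g := Finset.univ.gcd z
  replace hzΞ : ∀ J, (z J : ℝ) = g * Ξ J := fun J => by exact_mod_cast hzΞ J (Finset.mem_univ J)
  have hg : g ≠ 0 := fun h => mul_ne_zero hc hI (by rw [← hz, hzΞ, h, Int.cast_zero, zero_mul])
  have hg' : (g : ℝ) ≠ 0 := Int.cast_ne_zero.2 hg
  have hprim : IsPrimitivePlucker (span ℝ (Set.range v)) Ξ := by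
    refine ⟨hgcd, Basis.span hv, c / g, div_ne_zero hc hg', fun J => ?_⟩
    simp only [Basis.span_apply]
    rw [div_mul_eq_mul_div, ← hz, hzΞ, mul_div_cancel_left₀ _ hg']
  rw [hprim.height_eq]
  refine (sqrt_sum_sq_le_sum_abs _ _).trans (Finset.sum_le_sum fun J _ => ?_)
  rw [hzΞ, abs_mul]
  exact le_mul_of_one_le_left (abs_nonneg _) (by exact_mod_cast Int.one_le_abs hg)

end Heights

section PluckerCoordinates

variable {n m : ℕ}

theorem pluckerCoord_sum_smul (M : Matrix (Fin m) (Fin m) ℝ) (v : Fin m → EucSp n)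
    (I : Fin m ↪o Fin n) :
    pluckerCoord (fun k => ∑ l, M k l • v l) I = M.det * pluckerCoord v I := by
  rw [pluckerCoord, pluckerCoord, ← Matrix.det_mul]
  congr 1
  ext k l
  simp [Matrix.mul_apply]

theorem pluckerCoord_cons (x : EucSp n) (v : Fin m → EucSp n) (J : Fin (m + 1) ↪o Fin n) :
    pluckerCoord (Fin.cons x v : Fin (m + 1) → EucSp n) J =
      ∑ s : Fin (m + 1), (-1) ^ (s : ℕ) * x (J s) *
        pluckerCoord v ((Fin.succAboveOrderEmb s).trans J) := by
  rw [pluckerCoord, Matrix.det_succ_row_zero]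
  rfl

theorem linearIndependent_of_pluckerCoord_ne_zero {v : Fin m → EucSp n} {I : Fin m ↪o Fin n}
    (h : pluckerCoord v I ≠ 0) : LinearIndependent ℝ v :=
  .of_comp (LinearMap.pi fun l => (EuclideanSpace.proj (𝕜 := ℝ) (I l)).toLinearMap)
    (Matrix.linearIndependent_rows_of_det_ne_zero h)

theorem pluckerCoord_cons_eq_of_sub_mem {x y : EucSp n} {v : Fin m → EucSp n}
    (h : x - y ∈ span ℝ (Set.range v)) (J : Fin (m + 1) ↪o Fin n) :
    pluckerCoord (Fin.cons x v : Fin (m + 1) → EucSp n) J =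
      pluckerCoord (Fin.cons y v : Fin (m + 1) → EucSp n) J := by
  have hzero : pluckerCoord (Fin.cons (x - y) v : Fin (m + 1) → EucSp n) J = 0 := by
    by_contra h0
    exact (linearIndependent_finCons.1 (linearIndependent_of_pluckerCoord_ne_zero h0)).2 h
  rw [← sub_eq_zero, ← hzero]
  simp only [pluckerCoord_cons, ← Finset.sum_sub_distrib, PiLp.sub_apply]
  exact Finset.sum_congr rfl fun s _ => by ring

end PluckerCoordinates

section Echelon

variable {n m : ℕ} {v : Fin m → EucSp n} {I : Fin m → Fin n} {q : ℝ}

/-- The coordinates of the family `v` of `m` vectors of `ℝⁿ` at the indices `I 0, …, I (m - 1)` form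
the matrix `q • 1`. For `q = 1` this is the reduced echelon form with pivots `I`; a general `q`
occurs as the common denominator of a rational family in reduced echelon form. -/
def IsEchelon (v : Fin m → EucSp n) (I : Fin m → Fin n) (q : ℝ) : Prop :=
  ∀ k l, v k (I l) = if k = l then q else 0

namespace IsEchelon

theorem sum_smul_apply (h : IsEchelon v I q) (a : Fin m → ℝ) (l : Fin m) :
    (∑ k, a k • v k) (I l) = a l * q := by
  simp [h _ l]

theorem linearIndependent (h : IsEchelon v I q) (hq : q ≠ 0) : LinearIndependent ℝ v := by
  refine Fintype.linearIndependent_iff.2 fun a ha l => ?_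
  have hl := h.sum_smul_apply a l
  rw [ha] at hl
  exact (mul_eq_zero.1 hl.symm).resolve_right hq

theorem smul_eq_sum (h : IsEchelon v I q) {x : EucSp n} (hx : x ∈ span ℝ (Set.range v)) :
    q • x = ∑ k, x (I k) • v k := by
  obtain ⟨a, rfl⟩ := (mem_span_range_iff_exists_fun ℝ).1 hx
  simp only [h.sum_smul_apply, Finset.smul_sum, smul_smul, mul_comm]

theorem eq_of_apply_eq (h : IsEchelon v I q) (hq : q ≠ 0) {x y : EucSp n}
    (hx : x ∈ span ℝ (Set.range v)) (hy : y ∈ span ℝ (Set.range v))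
    (hxy : ∀ l, x (I l) = y (I l)) : x = y := by
  refine smul_right_injective _ hq ?_
  simp only [h.smul_eq_sum hx, h.smul_eq_sum hy, hxy]

theorem pluckerCoord_eq {I : Fin m ↪o Fin n} (h : IsEchelon v I q) : pluckerCoord v I = q ^ m := by
  have hM : (Matrix.of fun k l => v k (I l)) = Matrix.diagonal fun _ => q := by
    ext k l
    exact h k l
  rw [pluckerCoord, hM, Matrix.det_diagonal, Finset.prod_const, Finset.card_fin]

end IsEchelon

theorem exists_isEchelon_one {I : Fin m ↪o Fin n} (hI : pluckerCoord v I ≠ 0) :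
    ∃ y : Fin m → EucSp n, IsEchelon y I 1 ∧ span ℝ (Set.range y) = span ℝ (Set.range v) := by
  set M : Matrix (Fin m) (Fin m) ℝ := Matrix.of fun k l => v k (I l)
  have hy : IsEchelon (fun k => ∑ l, M⁻¹ k l • v l) I 1 := fun k l => by
    rw [← Matrix.one_apply, ← Matrix.nonsing_inv_mul M (isUnit_iff_ne_zero.2 hI)]
    simp [Matrix.mul_apply, M]
  refine ⟨_, hy, eq_of_le_of_finrank_le (span_le.2 ?_) ?_⟩
  · rintro _ ⟨k, rfl⟩
    exact sum_mem fun l _ => smul_mem _ _ (subset_span ⟨l, rfl⟩)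
  · rw [finrank_span_eq_card (hy.linearIndependent one_ne_zero)]
    exact finrank_range_le_card v

theorem exists_isEchelon_one_of_finrank {A : Submodule ℝ (EucSp n)} (hA : finrank ℝ A = m) :
    ∃ (I : Fin m ↪o Fin n) (y : Fin m → EucSp n), IsEchelon y I 1 ∧ span ℝ (Set.range y) = A := by
  obtain ⟨I, hI⟩ := exists_pluckerCoord_ne_zero (finBasisOfFinrankEq ℝ A hA)
  obtain ⟨y, hy, hspan⟩ := exists_isEchelon_one hI
  exact ⟨I, y, hy, hspan.trans (span_range_coe_basis _)⟩

end Echelon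

section IntegerPoints

variable {n m : ℕ}

/-- The integer point of `ℝⁿ` with coordinates `z`, as an additive homomorphism so that its range is
the lattice `ℤⁿ` of `ℝⁿ`. -/
noncomputable def intVec : (Fin n → ℤ) →+ EucSp n :=
  (WithLp.linearEquiv 2 ℝ (Fin n → ℝ)).symm.toLinearMap.toAddMonoidHom.comp
    ((Int.castAddHom ℝ).compLeft (Fin n))

@[simp]
theorem intVec_apply (z : Fin n → ℤ) (i : Fin n) : intVec z i = z i :=
  rfl

theorem pluckerCoord_intVec (p : Fin m → Fin n → ℤ) (I : Fin m ↪o Fin n) :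
    pluckerCoord (fun k => intVec (p k)) I = (Matrix.of fun k l => p k (I l)).det :=
  ((Int.castRingHom ℝ).map_det _).symm

/-- The lattice of the integer coordinate vectors `u` for which `∑ k, u k • y k` lies in `ℤⁿ`. -/
noncomputable def integralCombinations (y : Fin m → EucSp n) : AddSubgroup (Fin m → ℤ) :=
  (intVec (n := n)).range.comap (Fintype.linearCombination ℤ y).toAddMonoidHom

variable {y : Fin m → EucSp n} {Ξ : (Fin m ↪o Fin n) → ℤ} {I : Fin m ↪o Fin n}

theorem mem_integralCombinations {u : Fin m → ℤ} :
    u ∈ integralCombinations y ↔ ∃ z, intVec z = Fintype.linearCombination ℤ y u :=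
  Iff.rfl

theorem linearCombination_int_eq_sum (y : Fin m → EucSp n) (u : Fin m → ℤ) :
    Fintype.linearCombination ℤ y u = ∑ k, (u k : ℝ) • y k := by
  simp only [Fintype.linearCombination_apply, Int.cast_smul_eq_zsmul]

/-- The Plücker coordinates `det U / Ξ I * Ξ J` of the integral combinations given by the rows of
`U` are integers, while the `Ξ J` are coprime. -/
theorem IsPrimitivePlucker.dvd_det (h : IsPrimitivePlucker (span ℝ (Set.range y)) Ξ)
    (hy : IsEchelon y I 1) {U : Matrix (Fin m) (Fin m) ℤ}
    (hU : ∀ k, U k ∈ integralCombinations y) : Ξ I ∣ U.det := by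
  obtain ⟨c, -, hΞ⟩ := h.exists_eq_mul_pluckerCoord (hy.linearIndependent one_ne_zero)
  have hc : (Ξ I : ℝ) = c := by rw [hΞ, hy.pluckerCoord_eq, one_pow, mul_one]
  choose Z hZ using fun k => mem_integralCombinations.1 (hU k)
  have hdet : ∀ J, U.det * Ξ J = Ξ I * (Matrix.of fun k l => Z k (J l)).det := fun J => by
    have hcoord := pluckerCoord_sum_smul (U.map (Int.castRingHom ℝ)) y J
    simp only [Matrix.map_apply, eq_intCast, ← linearCombination_int_eq_sum] at hcoord
    rw [← funext hZ, pluckerCoord_intVec, ← RingHom.mapMatrix_apply, ← RingHom.map_det,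
      eq_intCast] at hcoord
    have hreal : (U.det : ℝ) * Ξ J = Ξ I * (Matrix.of fun k l => Z k (J l)).det := by
      rw [hcoord, hΞ J, hc]
      ring
    exact_mod_cast hreal
  have hgcd : Finset.univ.gcd (fun J => U.det * Ξ J) = normalize U.det := by
    rw [Finset.gcd_mul_left, h.1, mul_one]
  exact dvd_normalize_iff.1 (hgcd ▸ Finset.dvd_gcd fun J _ => ⟨_, hdet J⟩)

theorem IsPrimitivePlucker.natAbs_le_card_quotient
    (h : IsPrimitivePlucker (span ℝ (Set.range y)) Ξ) (hy : IsEchelon y I 1) :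
    ((Ξ I).natAbs : ℕ∞) ≤ ENat.card ((Fin m → ℤ) ⧸ integralCombinations y) := by
  rcases finite_or_infinite ((Fin m → ℤ) ⧸ integralCombinations y) with hfin | hinf
  · obtain ⟨f⟩ := Int.addSubgroup_index_ne_zero_iff.1
      (Nat.card_pos.ne' : (integralCombinations y).index ≠ 0)
    let b : Basis (Fin m) ℤ (integralCombinations y) := Basis.ofEquivFun f.toIntLinearEquiv
    have hdvd := h.dvd_det hy (U := Matrix.of fun k => (b k : Fin m → ℤ)) fun k => (b k).2
    have hdet := AddSubgroup.index_eq_natAbs_det (Pi.basisFun ℤ (Fin m)) _ b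
    rw [Pi.basisFun_det_apply] at hdet
    rw [ENat.card_eq_coe_natCard, Nat.cast_le]
    exact Nat.le_of_dvd Nat.card_pos ((Int.natAbs_dvd_natAbs.2 hdvd).trans hdet.symm.dvd)
  · rw [ENat.card_eq_top_of_infinite]
    exact le_top

theorem card_notMem_range (I : Fin m ↪o Fin n) [Fintype {i // i ∉ Set.range I}] :
    Fintype.card {i // i ∉ Set.range I} = n - m := by
  rw [← Nat.card_eq_fintype_card]
  change (Set.range I)ᶜ.ncard = n - m
  rw [Set.ncard_compl, Set.ncard_range_of_injective I.injective, Nat.card_fin, Nat.card_fin]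

theorem exists_ne_abs_sub_round_le {α ι : Type*} [Fintype ι] {K : ℕ} (hK : K ≠ 0) (g : α → ι → ℝ)
    (h : ((K ^ Fintype.card ι : ℕ) : ℕ∞) < ENat.card α) :
    ∃ x x', x ≠ x' ∧ ∀ i, |g x i - g x' i - round (g x i - g x' i)| ≤ 1 / K := by
  have hK' : (0 : ℝ) < K := Nat.cast_pos.2 (Nat.pos_of_ne_zero hK)
  have hnonneg : ∀ x i, 0 ≤ K * Int.fract (g x i) := fun x i =>
    mul_nonneg hK'.le (Int.fract_nonneg _)
  let box : α → ι → Fin K := fun x i =>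
    ⟨⌊K * Int.fract (g x i)⌋₊, (Nat.floor_lt (hnonneg x i)).2
      (mul_lt_of_lt_one_right hK' (Int.fract_lt_one _))⟩
  obtain ⟨x, x', hbox, hne⟩ : ∃ x x', box x = box x' ∧ x ≠ x' := by
    by_contra! hinj
    refine h.not_ge ((ENat.card_le_card_of_injective (f := box) hinj).trans_eq ?_)
    simp
  refine ⟨x, x', hne, fun i => (round_le _ (⌊g x i⌋ - ⌊g x' i⌋)).trans ?_⟩
  have hfloor : ⌊K * Int.fract (g x i)⌋ = ⌊K * Int.fract (g x' i)⌋ := by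
    rw [← Int.natCast_floor_eq_floor (hnonneg x i), ← Int.natCast_floor_eq_floor (hnonneg x' i)]
    exact congrArg (fun b => (b.1 : ℤ)) (congrFun hbox i)
  have hlt := Int.abs_sub_lt_one_of_floor_eq_floor hfloor
  rw [← mul_sub, abs_mul, abs_of_pos hK', ← Int.self_sub_floor, ← Int.self_sub_floor] at hlt
  rw [le_div_iff₀' hK', Int.cast_sub, sub_sub_sub_comm]
  exact hlt.le

/-- Modulo the lattice of integral combinations, the integer combinations of the `y k` are
pairwise distinct points of the torus; two of them are close by the pigeonhole principle. -/
theorem IsPrimitivePlucker.exists_intVec_near_of_pow_lt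
    (h : IsPrimitivePlucker (span ℝ (Set.range y)) Ξ) (hy : IsEchelon y I 1) {K : ℕ} (hK : K ≠ 0)
    (hlt : K ^ (n - m) < (Ξ I).natAbs) : ∃ z : Fin n → ℤ, intVec z ∉ span ℝ (Set.range y) ∧
      ∃ s ∈ span ℝ (Set.range y), ∀ i, |z i - s i| ≤ 1 / K := by
  set L := Fintype.linearCombination ℤ y with hL
  obtain ⟨x, x', hne, hround⟩ := exists_ne_abs_sub_round_le hK
    (fun (x : (Fin m → ℤ) ⧸ integralCombinations y) (i : {i // i ∉ Set.range I}) => L x.out i)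
    (by
      rw [card_notMem_range]
      exact (Nat.cast_lt.2 hlt).trans_le (h.natAbs_le_card_quotient hy))
  set u := x.out - x'.out with hu
  have hu_notMem : u ∉ integralCombinations y := fun hmem => hne <| by
    rw [← x.out_eq', ← x'.out_eq']
    exact (QuotientAddGroup.eq_iff_sub_mem.2 hmem)
  have hmem : L u ∈ span ℝ (Set.range y) := by
    rw [hL, linearCombination_int_eq_sum]
    exact sum_mem fun k _ => smul_mem _ _ (subset_span ⟨k, rfl⟩)
  have hpivot : ∀ l, L u (I l) = u l := fun l => by
    rw [hL, linearCombination_int_eq_sum, hy.sum_smul_apply, mul_one]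
  set z : Fin n → ℤ := fun i => round (L u i)
  have hz_pivot : ∀ l, z (I l) = u l := fun l => by
    change round (L u (I l)) = u l
    rw [hpivot, round_intCast]
  refine ⟨z, fun hzB => hu_notMem (mem_integralCombinations.2 ⟨z, hy.eq_of_apply_eq one_ne_zero
    hzB hmem fun l => ?_⟩), L u, hmem, fun i => ?_⟩
  · rw [intVec_apply, hz_pivot, hpivot]
  · by_cases hi : i ∈ Set.range I
    · obtain ⟨l, rfl⟩ := hi
      rw [hz_pivot, hpivot, sub_self, abs_zero]
      positivity
    · have hLu : L u i = L x.out i - L x'.out i := by rw [hu, map_sub, PiLp.sub_apply]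
      change |round (L u i) - L u i| ≤ 1 / (K : ℝ)
      rw [abs_sub_comm, hLu]
      exact hround ⟨i, hi⟩

theorem exists_intVec_single_notMem {B : Submodule ℝ (EucSp n)} (hB : B ≠ ⊤) :
    ∃ i, intVec (Pi.single i 1) ∉ B := by
  by_contra! hmem
  refine hB (eq_top_iff.2 ?_)
  rw [← (EuclideanSpace.basisFun (Fin n) ℝ).toBasis.span_eq, span_le]
  rintro _ ⟨i, rfl⟩
  have hbasis : (EuclideanSpace.basisFun (Fin n) ℝ).toBasis i = intVec (Pi.single i 1) := by
    ext k
    simp [Pi.single_apply]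
  exact hbasis ▸ hmem i

theorem IsPrimitivePlucker.exists_intVec_near {B : Submodule ℝ (EucSp n)} (hm : m < n)
    (h : IsPrimitivePlucker B Ξ) (hI : Ξ I ≠ 0) :
    ∃ K : ℕ, 0 < K ∧ (Ξ I).natAbs ≤ (2 * K) ^ (n - m) ∧ ∃ z : Fin n → ℤ, intVec z ∉ B ∧
      ∃ s ∈ B, ∀ i, |z i - s i| ≤ 1 / K := by
  have hr : n - m ≠ 0 := Nat.sub_ne_zero_of_lt hm
  obtain hD | hD : (Ξ I).natAbs = 1 ∨ 1 < (Ξ I).natAbs := by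
    have := Int.natAbs_pos.2 hI
    omega
  · obtain ⟨i, hi⟩ := exists_intVec_single_notMem (B := B) fun hB => by
      obtain ⟨-, b, -⟩ := h
      have hfin := finrank_eq_card_basis b
      rw [hB, finrank_top, finrank_euclideanSpace_fin, Fintype.card_fin] at hfin
      exact hm.ne' hfin
    refine ⟨1, one_pos, hD.trans_le (Nat.one_le_pow _ _ two_pos), _, hi, 0, B.zero_mem,
      fun k => ?_⟩
    rcases eq_or_ne k i with rfl | hk
    · simp
    · simp [hk]
  · obtain ⟨-, b, c, -, hb⟩ := id h
    obtain ⟨y, hy, hspan⟩ := exists_isEchelon_one (v := fun k => (b k : EucSp n)) (I := I)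
      fun h0 => hI (Int.cast_eq_zero.1 ((hb I).trans (by rw [h0, mul_zero])))
    rw [span_range_coe_basis] at hspan
    subst hspan
    obtain ⟨K, hK_le, hK_lt⟩ : ∃ K, K ^ (n - m) ≤ (Ξ I).natAbs - 1 ∧
        (Ξ I).natAbs - 1 < (K + 1) ^ (n - m) :=
      ⟨_, Nat.pow_nthRoot_le (Or.inl hr), Nat.lt_pow_nthRoot_add_one hr _⟩
    have hK : 0 < K := Nat.pos_of_ne_zero fun h0 => by
      rw [h0, zero_add, one_pow] at hK_lt
      lia
    have hD_le : (Ξ I).natAbs ≤ (K + 1) ^ (n - m) := by lia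
    exact ⟨K, hK, hD_le.trans (Nat.pow_le_pow_left (by lia) _),
      h.exists_intVec_near_of_pow_lt hy hK.ne' (by lia)⟩

end IntegerPoints

section GoingUp

variable {n m : ℕ}

/-- Replacing `z` by the small vector `z - s` does not change the Plücker coordinates of the
subspace spanned by `z` and the `v k`. -/
theorem IsPrimitivePlucker.height_span_cons_le {v : Fin m → EucSp n} {Ξ : (Fin m ↪o Fin n) → ℤ}
    (h : IsPrimitivePlucker (span ℝ (Set.range v)) Ξ) (hv : LinearIndependent ℝ v)
    {z : Fin n → ℤ} (hz : intVec z ∉ span ℝ (Set.range v)) {s : EucSp n}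
    (hs : s ∈ span ℝ (Set.range v)) {δ D : ℝ} (hδ : ∀ i, |z i - s i| ≤ δ)
    (hD : ∀ J, |(Ξ J : ℝ)| ≤ D) :
    height (m + 1) (span ℝ (Set.range (Fin.cons (intVec z) v : Fin (m + 1) → EucSp n))) ≤
      Fintype.card (Fin (m + 1) ↪o Fin n) * ((m + 1) * (δ * D)) := by
  obtain ⟨c, hc, hΞ⟩ := h.exists_eq_mul_pluckerCoord hv
  have hlaplace : ∀ (x : EucSp n) J,
      c * pluckerCoord (Fin.cons x v : Fin (m + 1) → EucSp n) J =
        ∑ t : Fin (m + 1), (-1) ^ (t : ℕ) * x (J t) * Ξ ((Fin.succAboveOrderEmb t).trans J) :=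
    fun x J => by
      rw [pluckerCoord_cons, Finset.mul_sum]
      exact Finset.sum_congr rfl fun t _ => by rw [hΞ]; ring
  let W : (Fin (m + 1) ↪o Fin n) → ℤ := fun J =>
    ∑ t : Fin (m + 1), (-1) ^ (t : ℕ) * z (J t) * Ξ ((Fin.succAboveOrderEmb t).trans J)
  have hW : ∀ J, (W J : ℝ) =
      c * pluckerCoord (Fin.cons (intVec z) v : Fin (m + 1) → EucSp n) J := fun J => by
    rw [hlaplace]
    push_cast [W, intVec_apply]
    rfl
  have hW_le : ∀ J, |(W J : ℝ)| ≤ (m + 1) * (δ * D) := fun J => by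
    rw [hW, ← pluckerCoord_cons_eq_of_sub_mem (x := intVec z - s)
      (by rwa [sub_sub_cancel_left, neg_mem_iff]), hlaplace]
    calc |∑ t : Fin (m + 1), (-1 : ℝ) ^ (t : ℕ) * (intVec z - s) (J t) *
            Ξ ((Fin.succAboveOrderEmb t).trans J)|
        ≤ ∑ t : Fin (m + 1), |(z (J t) : ℝ) - s (J t)| *
            |(Ξ ((Fin.succAboveOrderEmb t).trans J) : ℝ)| := by
          refine (Finset.abs_sum_le_sum_abs _ _).trans_eq (Finset.sum_congr rfl fun t _ => ?_)
          rw [abs_mul, abs_mul, abs_neg_one_pow, one_mul, PiLp.sub_apply, intVec_apply]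
      _ ≤ ∑ _t : Fin (m + 1), δ * D := Finset.sum_le_sum fun t _ =>
          mul_le_mul (hδ _) (hD _) (abs_nonneg _) ((abs_nonneg _).trans (hδ (J t)))
      _ = (m + 1) * (δ * D) := by simp
  refine (height_span_le (linearIndependent_finCons.2 ⟨hv, hz⟩) hc hW).trans ?_
  refine (Finset.sum_le_card_nsmul _ _ _ fun J _ => hW_le J).trans_eq ?_
  rw [nsmul_eq_mul, Finset.card_univ]

theorem div_le_two_mul_rpow {D K r : ℝ} (hD : 0 < D) (hK : 0 < K) (hr : 0 < r)
    (h : D ≤ (2 * K) ^ r) : D / K ≤ 2 * D ^ ((r - 1) / r) := by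
  have hroot : D ^ (1 / r) ≤ 2 * K :=
    (Real.rpow_le_rpow hD.le h (by positivity)).trans_eq
      (by rw [← Real.rpow_mul (by positivity), mul_one_div_cancel hr.ne', Real.rpow_one])
  calc D / K = D ^ ((r - 1) / r) * D ^ (1 / r) / K := by
        rw [← Real.rpow_add hD, ← add_div, sub_add_cancel, div_self hr.ne', Real.rpow_one]
    _ ≤ D ^ ((r - 1) / r) * (2 * K) / K := by gcongr
    _ = 2 * D ^ ((r - 1) / r) := by field_simp

theorem exists_rational_succ (hm : m < n) : ∃ κ : ℝ, 0 ≤ κ ∧ ∀ B ∈ rationalSubspaces n m,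
    ∃ C ∈ rationalSubspaces n (m + 1), B ≤ C ∧
      height (m + 1) C ≤ κ * height m B ^ (((n : ℝ) - (m + 1)) / (n - m)) := by
  refine ⟨Fintype.card (Fin (m + 1) ↪o Fin n) * ((m + 1) * 2), by positivity, fun B hB => ?_⟩
  obtain ⟨v, hv, hv_rat, rfl⟩ := mem_rationalSubspaces_iff.1 hB
  obtain ⟨Ξ, hΞ⟩ := exists_isPrimitivePlucker hB
  obtain ⟨I₀, hI₀⟩ := hΞ.exists_ne_zero
  obtain ⟨I, -, hI⟩ := Finset.exists_max_image Finset.univ (fun J => |Ξ J|) ⟨I₀, Finset.mem_univ _⟩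
  have hI_ne : Ξ I ≠ 0 := abs_pos.1 ((abs_pos.2 hI₀).trans_le (hI I₀ (Finset.mem_univ _)))
  obtain ⟨K, hK, hDK, z, hz, s, hs, hzs⟩ := hΞ.exists_intVec_near hm hI_ne
  refine ⟨span ℝ (Set.range (Fin.cons (intVec z) v : Fin (m + 1) → EucSp n)),
    mem_rationalSubspaces_iff.2 ⟨_, linearIndependent_finCons.2 ⟨hv, hz⟩,
      Fin.cases (fun i => ⟨z i, by simp⟩) hv_rat, rfl⟩, ?_, ?_⟩
  · rw [Fin.range_cons]
    exact span_mono (Set.subset_insert _ _)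
  have hr : 0 < (n : ℝ) - m := sub_pos.2 (Nat.cast_lt.2 hm)
  set D : ℝ := |(Ξ I : ℝ)| with hD
  have hΞ_le : ∀ J, |(Ξ J : ℝ)| ≤ D := fun J => by
    rw [hD]
    exact_mod_cast hI J (Finset.mem_univ J)
  have hD_pos : 0 < D := abs_pos.2 (Int.cast_ne_zero.2 hI_ne)
  have hD_le : D / K ≤ 2 * D ^ (((n : ℝ) - (m + 1)) / (n - m)) := by
    rw [← sub_sub]
    refine div_le_two_mul_rpow hD_pos (Nat.cast_pos.2 hK) hr ?_
    rw [← Nat.cast_sub hm.le, Real.rpow_natCast, hD, ← Int.cast_abs, ← Nat.cast_natAbs]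
    exact_mod_cast hDK
  refine (hΞ.height_span_cons_le hv hz hs hzs hΞ_le).trans ?_
  rw [one_div_mul_eq_div, mul_assoc, mul_assoc]
  gcongr _ * (_ * ?_)
  have hexp : 0 ≤ ((n : ℝ) - (m + 1)) / (n - m) :=
    div_nonneg (sub_nonneg.2 (by exact_mod_cast hm)) hr.le
  refine hD_le.trans ?_
  gcongr
  exact hΞ.abs_le_height I

theorem exists_rational_of_le {j e : ℕ} (hje : j ≤ e) (hen : e < n) : ∃ κ : ℝ, 0 ≤ κ ∧
    ∀ B ∈ rationalSubspaces n j, ∃ C ∈ rationalSubspaces n e, B ≤ C ∧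
      height e C ≤ κ * height j B ^ (((n : ℝ) - e) / (n - j)) := by
  induction e, hje using Nat.le_induction with
  | base =>
    refine ⟨1, zero_le_one, fun B hB => ⟨B, hB, le_rfl, ?_⟩⟩
    rw [div_self (sub_pos.2 (Nat.cast_lt.2 hen)).ne', Real.rpow_one, one_mul]
  | succ e _ ih =>
    have he : (0 : ℝ) < n - e := sub_pos.2 (Nat.cast_lt.2 (by lia))
    have he' : (0 : ℝ) ≤ (n : ℝ) - (e + 1) := sub_nonneg.2 (by exact_mod_cast hen.le)
    obtain ⟨κ, hκ, hup⟩ := ih (by lia)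
    obtain ⟨κ', hκ', hsucc⟩ := exists_rational_succ (n := n) (m := e) (by lia)
    refine ⟨κ' * κ ^ (((n : ℝ) - (e + 1)) / (n - e)), by positivity, fun B hB => ?_⟩
    obtain ⟨C, hC, hBC, hheight⟩ := hup B hB
    obtain ⟨C', hC', hCC', hheight'⟩ := hsucc C hC
    have hB0 : 0 ≤ height j B := zero_le_one.trans (one_le_height hB)
    refine ⟨C', hC', hBC.trans hCC', hheight'.trans ?_⟩
    calc κ' * height e C ^ (((n : ℝ) - (e + 1)) / (n - e))
        ≤ κ' * (κ * height j B ^ (((n : ℝ) - e) / (n - j))) ^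
            (((n : ℝ) - (e + 1)) / (n - e)) := by
          gcongr
          exact zero_le_one.trans (one_le_height hC)
      _ = κ' * κ ^ (((n : ℝ) - (e + 1)) / (n - e)) *
            height j B ^ (((n : ℝ) - (e + 1 : ℕ)) / (n - j)) := by
          rw [Real.mul_rpow hκ (by positivity), ← Real.rpow_mul hB0, ← mul_assoc, Nat.cast_succ]
          congr 2
          field_simp

end GoingUp

section DirichletApproximation

theorem exists_nat_abs_mul_sub_round_le {ι : Type*} [Fintype ι] (θ : ι → ℝ) {Q : ℕ} (hQ : 0 < Q) :
    ∃ q : ℕ, 0 < q ∧ q ≤ Q ^ Fintype.card ι ∧ ∀ i, |q * θ i - round (q * θ i)| ≤ 1 / Q := by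
  obtain ⟨x, x', hne, hround⟩ := exists_ne_abs_sub_round_le hQ.ne'
    (fun (x : Fin (Q ^ Fintype.card ι + 1)) i => (x : ℕ) * θ i)
    (by rw [ENat.card_eq_coe_fintype_card, Fintype.card_fin]; exact_mod_cast Nat.lt_succ_self _)
  simp only [← UnitAddCircle.norm_eq] at hround ⊢
  wlog hlt : x' < x generalizing x x'
  · refine this x' x hne.symm (fun i => ?_) (hne.lt_of_le (not_lt.1 hlt))
    rw [AddCircle.coe_sub, norm_sub_rev]
    exact hround i
  refine ⟨x - x', Nat.sub_pos_of_lt hlt, by lia, fun i => ?_⟩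
  rw [Nat.cast_sub (Fin.le_iff_val_le_val.1 hlt.le), sub_mul]
  exact hround i

variable {n d j m : ℕ} {A : Submodule ℝ (EucSp n)}

theorem norm_le_mul_of_forall_abs_le {x : EucSp n} {ε : ℝ} (h : ∀ i, |x i| ≤ ε) :
    ‖x‖ ≤ n * ε := by
  simp only [EuclideanSpace.norm_eq, Real.norm_eq_abs, sq_abs]
  refine (sqrt_sum_sq_le_sum_abs _ _).trans ?_
  refine (Finset.sum_le_card_nsmul _ _ ε fun i _ => h i).trans_eq ?_
  rw [nsmul_eq_mul, Finset.card_fin]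

theorem height_span_intVec_le {p : Fin m → Fin n → ℤ} {X : ℝ}
    (hp : LinearIndependent ℝ fun k => intVec (p k)) (hX : ∀ k i, |(p k i : ℝ)| ≤ X) :
    height m (span ℝ (Set.range fun k => intVec (p k))) ≤
      Fintype.card (Fin m ↪o Fin n) * (m.factorial * X ^ m) := by
  refine (height_span_le hp one_ne_zero fun I =>
    (pluckerCoord_intVec p I).symm.trans (one_mul _).symm).trans ?_
  refine (Finset.sum_le_card_nsmul _ _ (m.factorial * X ^ m) fun I _ => ?_).trans_eq
    (by rw [nsmul_eq_mul, Finset.card_univ])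
  have hdet := Matrix.det_le (A := Matrix.of fun k l => intVec (p k) (I l))
    (abv := AbsoluteValue.abs) fun k l => hX k (I l)
  rwa [Fintype.card_fin, nsmul_eq_mul, ← pluckerCoord, pluckerCoord_intVec] at hdet

theorem IsEchelon.isNear {v a : Fin m → EucSp n} {I : Fin m → Fin n} {q ε : ℝ}
    (h : IsEchelon v I q) (hq : 0 < q) (ha : ∀ k, a k ∈ A) (hε : ∀ k, ‖v k - a k‖ ≤ ε) :
    IsNear A (span ℝ (Set.range v)) (m * ε / q) := by
  intro x hx
  have hmem : q⁻¹ • ∑ k, x (I k) • a k ∈ A :=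
    A.smul_mem _ (A.sum_mem fun k _ => A.smul_mem _ (ha k))
  calc ‖x - A.starProjection x‖
      ≤ ‖x - q⁻¹ • ∑ k, x (I k) • a k‖ := norm_sub_starProjection_le_norm_sub x hmem
    _ = q⁻¹ * ‖∑ k, x (I k) • (v k - a k)‖ := by
        simp only [smul_sub, Finset.sum_sub_distrib, ← h.smul_eq_sum hx]
        rw [← norm_smul_of_nonneg (inv_nonneg.2 hq.le), smul_sub, inv_smul_smul₀ hq.ne']
    _ ≤ q⁻¹ * ∑ _k : Fin m, ‖x‖ * ε := by
        gcongr
        refine norm_sum_le_of_le _ fun k _ => (norm_smul_le _ _).trans ?_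
        exact mul_le_mul (PiLp.norm_apply_le x _) (hε k) (norm_nonneg _) (norm_nonneg _)
    _ = m * ε / q * ‖x‖ := by
        rw [Finset.sum_const, Finset.card_fin, nsmul_eq_mul]
        ring

theorem IsEchelon.exists_intVec_isEchelon {y : Fin d → EucSp n} {I : Fin d ↪o Fin n}
    (hy : IsEchelon y I 1) (f : Fin j ↪ Fin d) {Q : ℕ} (hQ : 0 < Q) :
    ∃ q : ℕ, 0 < q ∧ q ≤ Q ^ (j * (n - d)) ∧ ∃ p : Fin j → Fin n → ℤ,
      IsEchelon (fun k => intVec (p k)) (I ∘ f) q ∧ ∀ k i, |p k i - q * y (f k) i| ≤ 1 / Q := by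
  obtain ⟨q, hq, hqQ, hround⟩ := exists_nat_abs_mul_sub_round_le
    (fun p : Fin j × {i // i ∉ Set.range I} => y (f p.1) p.2) hQ
  rw [Fintype.card_prod, Fintype.card_fin, card_notMem_range] at hqQ
  have hpivot : ∀ k l, (q : ℝ) * y (f k) (I l) = (if f k = l then q else 0 : ℤ) := fun k l => by
    rw [hy]
    split_ifs <;> simp
  refine ⟨q, hq, hqQ, fun k i => round (q * y (f k) i), fun k l => ?_, fun k i => ?_⟩
  · rw [intVec_apply, Function.comp_apply]
    beta_reduce
    rw [hpivot, round_intCast]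
    simp only [f.injective.eq_iff, Int.cast_ite, Int.cast_natCast, Int.cast_zero]
  · by_cases hi : i ∈ Set.range I
    · obtain ⟨l, rfl⟩ := hi
      beta_reduce
      rw [hpivot, round_intCast, sub_self, abs_zero]
      positivity
    · rw [abs_sub_comm]
      exact hround (k, ⟨i, hi⟩)

theorem abs_le_add_one_mul_of_abs_sub_mul_le_one {a b q Y : ℝ} (hq : 1 ≤ q)
    (hab : |a - q * b| ≤ 1) (hb : |b| ≤ Y) : |a| ≤ (Y + 1) * q := by
  calc |a| ≤ |a - q * b| + |q * b| := sub_le_iff_le_add.1 (abs_sub_abs_le_abs_sub _ _)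
    _ ≤ q + q * Y := by
        rw [abs_mul, abs_of_nonneg (zero_le_one.trans hq)]
        gcongr
        exact hab.trans hq
    _ = (Y + 1) * q := by ring

theorem exists_rational_isNear (hA : finrank ℝ A = d) (hjd : j ≤ d) :
    ∃ c : ℝ, 0 ≤ c ∧ ∀ Q : ℕ, 0 < Q → ∃ q : ℕ, 0 < q ∧ q ≤ Q ^ (j * (n - d)) ∧
      ∃ B ∈ rationalSubspaces n j, height j B ≤ c * q ^ j ∧ IsNear A B (c / (q * Q)) := by
  obtain ⟨I, y, hy, rfl⟩ := exists_isEchelon_one_of_finrank hA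
  let Y : ℝ := ∑ k, ‖y k‖
  have : 0 ≤ Y := Finset.sum_nonneg fun k _ => norm_nonneg _
  have hyY : ∀ k i, |y k i| ≤ Y := fun k i => (PiLp.norm_apply_le (y k) i).trans
    (Finset.single_le_sum (fun k _ => norm_nonneg (y k)) (Finset.mem_univ k))
  let f : Fin j ↪ Fin d := Fin.castLEEmb hjd
  let c : ℝ := Fintype.card (Fin j ↪o Fin n) * (j.factorial * (Y + 1) ^ j)
  refine ⟨c + j * n, by positivity, fun Q hQ => ?_⟩
  obtain ⟨q, hq, hqQ, p, hp, hpy⟩ := hy.exists_intVec_isEchelon f hQ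
  have hq' : (1 : ℝ) ≤ q := by exact_mod_cast hq
  have hQ' : 1 / (Q : ℝ) ≤ 1 := by
    rw [one_div]
    exact Nat.cast_inv_le_one Q
  have hli := hp.linearIndependent (by positivity)
  have hp_le : ∀ k i, |(p k i : ℝ)| ≤ (Y + 1) * q := fun k i =>
    abs_le_add_one_mul_of_abs_sub_mul_le_one hq' ((hpy k i).trans hQ') (hyY _ i)
  have hdist : ∀ k, ‖intVec (p k) - (q : ℝ) • y (f k)‖ ≤ n * (1 / Q) := fun k =>
    norm_le_mul_of_forall_abs_le (hpy k)
  refine ⟨q, hq, hqQ, _, mem_rationalSubspaces_iff.2 ⟨_, hli, fun k i => ⟨p k i, by simp⟩, rfl⟩,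
    (height_span_intVec_le hli hp_le).trans ?_, ?_⟩
  · rw [mul_pow, ← mul_assoc, ← mul_assoc]
    gcongr
    rw [mul_assoc]
    exact le_add_of_nonneg_right (by positivity)
  · have hmem : ∀ k, (q : ℝ) • y (f k) ∈ span ℝ (Set.range y) := fun k =>
      smul_mem _ _ (subset_span ⟨f k, rfl⟩)
    refine (hp.isNear (by positivity) hmem hdist).mono ?_
    rw [mul_one_div, mul_div_assoc', div_div, mul_comm (Q : ℝ)]
    gcongr
    exact le_add_of_nonneg_left (by positivity)

end DirichletApproximation

section Exponents

variable {n d e j : ℕ} {A : Submodule ℝ (EucSp n)}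

theorem exists_rational_ge_of_isNear (hA : finrank ℝ A = d) (hjd : j ≤ d) (hje : j ≤ e)
    (hen : e < n) : ∃ c : ℝ, 0 ≤ c ∧ ∀ Q : ℕ, 0 < Q → ∃ q : ℕ, 0 < q ∧ q ≤ Q ^ (j * (n - d)) ∧
      ∃ C ∈ rationalSubspaces n e, height e C ≤ c * (q : ℝ) ^ (j * (((n : ℝ) - e) / (n - j))) ∧
        ∃ B ≤ C, finrank ℝ B = j ∧ IsNear A B (c / (q * Q)) := by
  obtain ⟨c, hc, happrox⟩ := exists_rational_isNear hA hjd
  obtain ⟨κ, hκ, hup⟩ := exists_rational_of_le hje hen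
  set s : ℝ := ((n : ℝ) - e) / (n - j)
  have hs : 0 ≤ s := div_nonneg (sub_nonneg.2 (Nat.cast_le.2 hen.le))
    (sub_nonneg.2 (Nat.cast_le.2 (hje.trans hen.le)))
  refine ⟨max c (κ * c ^ s), le_max_of_le_left hc, fun Q hQ => ?_⟩
  obtain ⟨q, hq, hqQ, B, hB, hheight, hnear⟩ := happrox Q hQ
  obtain ⟨C, hC, hBC, hheight'⟩ := hup B hB
  refine ⟨q, hq, hqQ, C, hC, ?_, B, hBC, finrank_of_mem_rationalSubspaces hB, hnear.mono ?_⟩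
  · calc height e C ≤ κ * height j B ^ s := hheight'
      _ ≤ κ * (c * q ^ j) ^ s := by
          gcongr
          exact zero_le_one.trans (one_le_height hB)
      _ = κ * c ^ s * (q : ℝ) ^ (j * s) := by
          rw [Real.mul_rpow hc (by positivity), ← Real.rpow_natCast_mul q.cast_nonneg, mul_assoc]
      _ ≤ max c (κ * c ^ s) * (q : ℝ) ^ (j * s) := by
          gcongr
          exact le_max_right _ _
  · gcongr
    exact le_max_left _ _

theorem eventually_forall_le_pow_mul_rpow_le {c t : ℝ} {M : ℕ} (hc : 0 ≤ c) (hM : 0 < M)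
    (ht : t < 1 + 1 / M) :
    ∀ᶠ Q : ℕ in atTop, ∀ q : ℕ, 0 < q → q ≤ Q ^ M → c * (q : ℝ) ^ t ≤ q * Q := by
  have hM' : (0 : ℝ) < M := Nat.cast_pos.2 hM
  set s := max (t - 1) 0
  have hs : s * M < 1 := by
    rw [← lt_div_iff₀ hM']
    exact max_lt (by linarith) (by positivity)
  have hlarge : ∀ᶠ Q : ℕ in atTop, c ≤ (Q : ℝ) ^ (1 - M * s) :=
    ((tendsto_rpow_atTop (by linarith)).comp tendsto_natCast_atTop_atTop).eventually_ge_atTop _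
  filter_upwards [hlarge, eventually_gt_atTop 0] with Q hcQ hQ q hq hqQ
  have hq' : (1 : ℝ) ≤ q := by exact_mod_cast hq
  have hQ' : (0 : ℝ) < Q := Nat.cast_pos.2 hQ
  calc c * (q : ℝ) ^ t ≤ c * (q : ℝ) ^ (1 + s) := by
        gcongr
        linarith [le_max_left (t - 1) 0]
    _ = q * (c * (q : ℝ) ^ s) := by
        rw [Real.rpow_add (by positivity), Real.rpow_one]
        ring
    _ ≤ q * ((Q : ℝ) ^ (1 - M * s) * ((Q : ℝ) ^ M) ^ s) := by
        gcongr
        exact_mod_cast hqQ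
    _ = q * Q := by
        rw [← Real.rpow_natCast_mul hQ'.le, ← Real.rpow_add hQ', sub_add_cancel, Real.rpow_one]

theorem infinite_setOf_psi_le (hA : A ∈ irrationalSubspaces n d e j) (hj : 1 ≤ j) (hjd : j ≤ d)
    (hje : j ≤ e) (hdn : d < n) (hen : e < n) {γ : ℝ} (hγ : 0 ≤ γ)
    (hγ_lt : j * (((n : ℝ) - e) / (n - j)) * γ < 1 + 1 / (j * ((n : ℝ) - d))) :
    {C ∈ rationalSubspaces n e | psi j A C ≤ 1 / height e C ^ γ}.Infinite := by
  obtain ⟨c, hc, happrox⟩ := exists_rational_ge_of_isNear hA.1 hjd hje hen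
  refine infinite_of_forall_exists_isNear (fun C hC => hA.2 C hC.1) fun ε hε => ?_
  have hM : 0 < j * (n - d) := Nat.mul_pos hj (Nat.sub_pos_of_lt hdn)
  have hcε : ∀ᶠ Q : ℕ in atTop, c / Q < ε :=
    (tendsto_const_div_atTop_nhds_zero_nat c).eventually (gt_mem_nhds hε)
  have hpow := eventually_forall_le_pow_mul_rpow_le (c := c * c ^ γ) (by positivity) hM
    (by rwa [Nat.cast_mul, Nat.cast_sub hdn.le])
  obtain ⟨Q, hQε, hQpow, hQ⟩ := (hcε.and (hpow.and (eventually_gt_atTop 0))).exists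
  obtain ⟨q, hq, hqQ, C, hC, hheight, B, hBC, hB, hnear⟩ := happrox Q hQ
  have hq' : (1 : ℝ) ≤ q := by exact_mod_cast hq
  have hC_pos : 0 < height e C := zero_lt_one.trans_le (one_le_height hC)
  refine ⟨C, ⟨hC, (psi_le_of_isNear hj (hA.1 ▸ hjd) hB hBC hnear).trans ?_⟩, B, hBC, hB,
    hnear.mono (le_trans ?_ hQε.le)⟩
  · rw [div_le_div_iff₀ (by positivity) (by positivity), one_mul]
    calc c * height e C ^ γ
        ≤ c * (c * (q : ℝ) ^ (j * (((n : ℝ) - e) / (n - j)))) ^ γ := by gcongr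
      _ = c * c ^ γ * (q : ℝ) ^ (j * (((n : ℝ) - e) / (n - j)) * γ) := by
          rw [Real.mul_rpow hc (by positivity), ← Real.rpow_mul q.cast_nonneg, ← mul_assoc]
      _ ≤ q * Q := hQpow q hq hqQ
  · gcongr
    exact le_mul_of_one_le_left Q.cast_nonneg hq'

theorem le_muExp {β : ℝ} (hβ : 0 < β) (h : ∀ γ, 0 < γ → γ < β →
    {C ∈ rationalSubspaces n e | psi j A C ≤ 1 / height e C ^ γ}.Infinite) :
    (β : EReal) ≤ muExp A e j := by
  refine EReal.ge_of_forall_gt_iff_ge.1 fun γ hγ => ?_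
  have hγβ : max γ (β / 2) < β := max_lt (EReal.coe_lt_coe_iff.1 hγ) (half_lt_self hβ)
  have hpos : 0 < max γ (β / 2) := lt_max_of_lt_right (half_pos hβ)
  exact (EReal.coe_le_coe_iff.2 (le_max_left _ _)).trans (le_sSup ⟨_, hpos, h _ hpos hγβ, rfl⟩)

end Exponents

theorem bound_le_of_pos {n d e j : ℝ} (hj : 0 < j) (hjn : j < n) (hdn : d < n) (hen : e < n) :
    (n - j) * (j * n - j * d + j ^ 2 / 2 + j / 2 + 1) /
        (j ^ 2 * (n - e) * (n - d + j / 2 + 1 / 2)) ≤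
      (n - j) / (j * (n - e)) * (1 + 1 / (j * (n - d))) := by
  have hd : 0 < n - d := sub_pos.2 hdn
  have he : 0 < n - e := sub_pos.2 hen
  have hj' : 0 < n - j := sub_pos.2 hjn
  calc (n - j) * (j * n - j * d + j ^ 2 / 2 + j / 2 + 1) /
        (j ^ 2 * (n - e) * (n - d + j / 2 + 1 / 2))
      = (n - j) / (j * (n - e)) * (1 + 1 / (j * (n - d + j / 2 + 1 / 2))) := by
        field_simp
    _ ≤ (n - j) / (j * (n - e)) * (1 + 1 / (j * (n - d))) := by
        gcongr
        linarith

theorem mainTheorem5_general {n d e j : ℕ} (hdn : d < n) (hen : e < n) (hj : 1 ≤ j) (hjd : j ≤ d)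
    (hje : j ≤ e) :
    ((((n : ℝ) - j) / (j * (n - e)) * (1 + 1 / (j * (n - d))) : ℝ) : EReal) ≤ muRing n d e j := by
  have : (0 : ℝ) < j := Nat.cast_pos.2 hj
  have hd : (0 : ℝ) < n - d := sub_pos.2 (Nat.cast_lt.2 hdn)
  have he : (0 : ℝ) < n - e := sub_pos.2 (Nat.cast_lt.2 hen)
  have hjn : (0 : ℝ) < n - j := sub_pos.2 (Nat.cast_lt.2 (hjd.trans_lt hdn))
  refine le_sInf ?_
  rintro _ ⟨A, hA, rfl⟩
  refine le_muExp (by positivity) fun γ hγ hγ_lt =>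
    infinite_setOf_psi_le hA hj hjd hje hdn hen hγ.le ?_
  rw [← lt_div_iff₀' (by positivity)]
  exact hγ_lt.trans_eq (by field_simp)

theorem mainTheorem5 (n d e j : ℕ) (hn : 4 ≤ n) (hde : d + e ≤ n) (hj : 1 ≤ j)
    (hjde : j ≤ min d e) :
    ((((n : ℝ) - j) * (j * n - j * d + (j : ℝ) ^ 2 / 2 + (j : ℝ) / 2 + 1) /
        ((j : ℝ) ^ 2 * ((n : ℝ) - e) * ((n : ℝ) - d + (j : ℝ) / 2 + 1 / 2)) : ℝ) : EReal)
      ≤ muRing n d e j := by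
  obtain ⟨hjd, hje⟩ := le_min_iff.1 hjde
  have hdn : d < n := by lia
  have hen : e < n := by lia
  exact (EReal.coe_le_coe_iff.2 (bound_le_of_pos (Nat.cast_pos.2 hj)
    (Nat.cast_lt.2 (hjd.trans_lt hdn)) (Nat.cast_lt.2 hdn) (Nat.cast_lt.2 hen))).trans
      (mainTheorem5_general hdn hen hj hjd hje)
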